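/- For integers $n,p,k\ge 1$ and reals $\tau$, $\sigma>0$ consider the Gaussian linear model $y_i=x_i^T\beta+\sigma z_i$, $i=1,\dots,n$, with $x_i\sim\mathcal N(0,\frac1n I_p)$ and $z_i\sim\mathcal N(0,1)$ all independent, and $\beta\in\mathbb R^p$ unknown. Let $$\Theta(k,\tau)=\{\beta\in\mathbb R^p:\ \|\beta\|_0\le k,\ \|\beta\|_2^2\le k\tau^2\},\qquad R(\Theta(k,\tau),\sigma)=\inf_{\hat\beta}\sup_{\beta\in\Theta(k,\tau)}\mathbb E_\beta\|\hat\beta-\beta\|_2^2,$$ where the infimum is over all measurable functions $\hat\beta$ of the data $(x_i,y_i)_{i\le n}$. For $\lambda>0$ let $\hat\beta^R(\lambda)=\arg\min_{b\in\mathbb R^p}\sum_{i=1}^n(y_i-x_i^Tb)^2+\lambda\|b\|_2^2$ be the ridge estimator. Let $n,p,k,\tau,\sigma$ vary along a sequence such that $k/p\to0$, $\tau/\sigma\to\infty$, $\tau/\sigma=o(\sqrt{\log(p/k)})$ (Regime II) and $(k\log(p/k))/n\to0$. Then $$\inf_{\lambda>0}\sup_{\beta\in\Theta(k,\tau)}\mathbb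 E_\beta\|\hat\beta^R(\lambda)-\beta\|_2^2\ \ge\ k\tau^2\Big(1-\frac{k\tau^2}{p\sigma^2}\big(1+o(1)\big)\Big).$$ Moreover ridge regression is minimax suboptimal in the second order: the improvement of optimally tuned ridge over $k\tau^2$ is negligible compared with that of the minimax risk, i.e. $$k\tau^2-\inf_{\lambda>0}\sup_{\beta\in\Theta(k,\tau)}\mathbb E_\beta\|\hat\beta^R(\lambda)-\beta\|_2^2\ =\ o\big(k\tau^2-R(\Theta(k,\tau),\sigma)\big).$$ -/

import Mathlib

open MeasureTheory ProbabilityTheory Filter Asymptotics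
open scoped Topology ENNReal NNReal Matrix

/-- The law of the pair `(X, z)`: the entries of the `n × p` design `X` are i.i.d. `N(0, 1/n)`
(that is, its rows are i.i.d. `N(0, I_p / n)`), the entries of the noise `z` are i.i.d. `N(0, 1)`,
and `X`, `z` are independent. -/
noncomputable def designNoiseLaw (n p : ℕ) : Measure ((Fin n → Fin p → ℝ) × (Fin n → ℝ)) :=
  (Measure.pi fun _ : Fin n => Measure.pi fun _ : Fin p => gaussianReal 0 ((n : ℝ≥0)⁻¹)).prod
    (Measure.pi fun _ : Fin n => gaussianReal 0 1)

/-- The response `y = X β + σ z`, coordinatewise `y_i = x_iᵀ β + σ z_i`. -/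
def response {n p : ℕ} (σ : ℝ) (β : EuclideanSpace ℝ (Fin p))
    (X : Fin n → Fin p → ℝ) (z : Fin n → ℝ) : Fin n → ℝ :=
  fun i => ∑ j, X i j * β j + σ * z i

/-- The risk `𝔼_β ‖β̂ - β‖₂²` of an estimator `β̂ = est (X, y)`, as a value in `[0, ∞]`. -/
noncomputable def risk {n p : ℕ} (σ : ℝ)
    (est : (Fin n → Fin p → ℝ) × (Fin n → ℝ) → EuclideanSpace ℝ (Fin p))
    (β : EuclideanSpace ℝ (Fin p)) : ℝ≥0∞ :=
  ∫⁻ ω, ENNReal.ofReal (‖est (ω.1, response σ β ω.1 ω.2) - β‖ ^ 2) ∂(designNoiseLaw n p)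

/-- The parameter space `Θ(k, τ) = {β ∈ ℝᵖ : ‖β‖₀ ≤ k, ‖β‖₂² ≤ k τ²}`. -/
def paramSpace (p k : ℕ) (τ : ℝ) : Set (EuclideanSpace ℝ (Fin p)) :=
  {β | {j | β j ≠ 0}.ncard ≤ k ∧ ‖β‖ ^ 2 ≤ k * τ ^ 2}

/-- The worst-case risk `sup_{β ∈ Θ(k, τ)} 𝔼_β ‖β̂ - β‖₂²` of an estimator. -/
noncomputable def supRisk {n p : ℕ} (k : ℕ) (τ σ : ℝ)
    (est : (Fin n → Fin p → ℝ) × (Fin n → ℝ) → EuclideanSpace ℝ (Fin p)) : ℝ≥0∞ :=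
  ⨆ β ∈ paramSpace p k τ, risk σ est β

/-- The minimax risk `R(Θ(k, τ), σ)`: the infimum of the worst-case risk over all estimators,
i.e. all measurable functions of the data `(X, y)`. -/
noncomputable def sparseMinimaxRisk (n p k : ℕ) (τ σ : ℝ) : ℝ≥0∞ :=
  ⨅ (est : (Fin n → Fin p → ℝ) × (Fin n → ℝ) → EuclideanSpace ℝ (Fin p))
    (_ : Measurable est), supRisk k τ σ est

/-- The ridge objective `∑ᵢ (yᵢ - xᵢᵀ b)² + lam ‖b‖₂²`. -/
noncomputable def ridgeObjective {n p : ℕ} (lam : ℝ) (X : Matrix (Fin n) (Fin p) ℝ)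
    (y : Fin n → ℝ) (b : EuclideanSpace ℝ (Fin p)) : ℝ :=
  ∑ i, (y i - ∑ j, X i j * b j) ^ 2 + lam * ‖b‖ ^ 2

/-- For `lam > 0` the ridge objective has exactly one minimizer, `(XᵀX + lam I)⁻¹ Xᵀ y`. -/
theorem isMinOn_ridgeObjective_iff {n p : ℕ} {lam : ℝ} (hlam : 0 < lam)
    (X : Matrix (Fin n) (Fin p) ℝ) (y : Fin n → ℝ) (b : EuclideanSpace ℝ (Fin p)) :
    IsMinOn (ridgeObjective lam X y) Set.univ b ↔
      b = WithLp.toLp 2 ((Xᵀ * X + lam • (1 : Matrix (Fin p) (Fin p) ℝ))⁻¹ *ᵥ (Xᵀ *ᵥ y)) := by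
  set A : Matrix (Fin p) (Fin p) ℝ := Xᵀ * X + lam • 1 with hA
  have hpos : A.PosDef := by
    have h1 : (Xᵀ * X).PosSemidef := by
      simpa using Matrix.posSemidef_conjTranspose_mul_self X
    exact Matrix.PosDef.posSemidef_add h1 (Matrix.PosDef.one.smul hlam)
  have hdet : IsUnit A.det := (Matrix.isUnit_iff_isUnit_det A).1 hpos.isUnit
  set c : Fin p → ℝ := A⁻¹ *ᵥ (Xᵀ *ᵥ y) with hc
  have hAc : A *ᵥ c = Xᵀ *ᵥ y := by
    rw [hc, Matrix.mulVec_mulVec, Matrix.mul_nonsing_inv A hdet, Matrix.one_mulVec]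
  have hobj : ∀ v : EuclideanSpace ℝ (Fin p), ridgeObjective lam X y v =
      (y - X *ᵥ v.ofLp) ⬝ᵥ (y - X *ᵥ v.ofLp) + lam * (v.ofLp ⬝ᵥ v.ofLp) := by
    intro v
    simp only [ridgeObjective, EuclideanSpace.real_norm_sq_eq, dotProduct, Matrix.mulVec,
      Pi.sub_apply]
    simp only [pow_two]
  have hkey : ∀ v : EuclideanSpace ℝ (Fin p), ridgeObjective lam X y v =
      ridgeObjective lam X y (WithLp.toLp 2 c) +
        ((X *ᵥ (v.ofLp - c)) ⬝ᵥ (X *ᵥ (v.ofLp - c)) +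
          lam * ((v.ofLp - c) ⬝ᵥ (v.ofLp - c))) := by
    intro v
    obtain ⟨d, hd⟩ : ∃ d, v.ofLp = c + d := ⟨v.ofLp - c, by simp⟩
    have hcross : (X *ᵥ c) ⬝ᵥ (X *ᵥ d) + lam * (c ⬝ᵥ d) = y ⬝ᵥ (X *ᵥ d) := by
      have h := congrArg (fun w => w ⬝ᵥ d) hAc
      simp only [hA, Matrix.add_mulVec, add_dotProduct, Matrix.smul_mulVec,
        Matrix.one_mulVec, smul_dotProduct, smul_eq_mul, ← Matrix.mulVec_mulVec] at h
      rw [Matrix.mulVec_transpose, Matrix.mulVec_transpose, ← Matrix.dotProduct_mulVec,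
        ← Matrix.dotProduct_mulVec] at h
      exact h
    rw [hobj, hobj, hd, add_sub_cancel_left, Matrix.mulVec_add]
    simp only [sub_dotProduct, dotProduct_sub, add_dotProduct, dotProduct_add]
    rw [dotProduct_comm (X *ᵥ d) (X *ᵥ c), dotProduct_comm d c, dotProduct_comm (X *ᵥ d) y]
    rw [← hcross]
    ring
  constructor
  · intro h
    have h1 := isMinOn_univ_iff.1 h (WithLp.toLp 2 c)
    rw [hkey b] at h1
    have h2 : 0 ≤ (X *ᵥ (b.ofLp - c)) ⬝ᵥ (X *ᵥ (b.ofLp - c)) :=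
      Finset.sum_nonneg fun i _ => mul_self_nonneg _
    have h3 : 0 ≤ (b.ofLp - c) ⬝ᵥ (b.ofLp - c) :=
      Finset.sum_nonneg fun i _ => mul_self_nonneg _
    have h4 : (b.ofLp - c) ⬝ᵥ (b.ofLp - c) = 0 := by
      rcases h3.eq_or_lt with h | h
      · exact h.symm
      · nlinarith [mul_pos hlam h]
    have h5 : b.ofLp - c = 0 := dotProduct_self_eq_zero.1 h4
    ext i
    have := congrFun h5 i
    simpa [sub_eq_zero] using this
  · rintro rfl
    refine isMinOn_univ_iff.2 fun v => ?_
    rw [hkey v]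
    have h2 : 0 ≤ (X *ᵥ (v.ofLp - c)) ⬝ᵥ (X *ᵥ (v.ofLp - c)) :=
      Finset.sum_nonneg fun i _ => mul_self_nonneg _
    have h3 : 0 ≤ (v.ofLp - c) ⬝ᵥ (v.ofLp - c) :=
      Finset.sum_nonneg fun i _ => mul_self_nonneg _
    nlinarith [mul_nonneg hlam.le h3]

/-- The ridge estimator: a minimizer of the ridge objective (the unique one when `lam > 0`). -/
noncomputable def ridgeEstimator {n p : ℕ} (lam : ℝ)
    (data : (Fin n → Fin p → ℝ) × (Fin n → ℝ)) : EuclideanSpace ℝ (Fin p) :=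
  Classical.epsilon fun b => IsMinOn (ridgeObjective lam data.1 data.2) Set.univ b

theorem ridgeEstimator_eq {n p : ℕ} {lam : ℝ} (hlam : 0 < lam)
    (X : Matrix (Fin n) (Fin p) ℝ) (y : Fin n → ℝ) :
    ridgeEstimator lam (X, y) =
      WithLp.toLp 2 ((Xᵀ * X + lam • (1 : Matrix (Fin p) (Fin p) ℝ))⁻¹ *ᵥ (Xᵀ *ᵥ y)) :=
  (isMinOn_ridgeObjective_iff hlam X y _).1
    (Classical.epsilon_spec ⟨_, (isMinOn_ridgeObjective_iff hlam X y _).2 rfl⟩)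

/-- The worst-case risk of optimally tuned ridge regression,
`inf_{lam > 0} sup_{β ∈ Θ(k, τ)} 𝔼_β ‖β̂ᴿ(lam) - β‖₂²`. -/
noncomputable def ridgeOptimalRisk (n p k : ℕ) (τ σ : ℝ) : ℝ≥0∞ :=
  ⨅ (lam : ℝ) (_ : 0 < lam), supRisk k τ σ (ridgeEstimator (n := n) (p := p) lam)

/-!
The ridge estimate is a matrix depending on `X` applied to `y`, so its mean risk under a prior on
`β` depends on the second moments of the prior only. The prior `√(k τ²) e_J`, with `J` uniform on
the `p` coordinates, is supported in `Θ(k, τ)` and has the second moments of an isotropic vector of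
squared length `k τ²`. Spread over all `p` coordinates, this signal lets no estimator linear in `y`
gain more than `(k τ²)² / (p σ²)` over the trivial risk `k τ²`.

Hard thresholding `Xᵀ y` at a level of order `τ` and shrinking by a small factor `c` does exploit
sparsity. The signal coordinates gain about `c k τ²`, while by a fourth-moment Chebyshev bound the
`p` null coordinates cost at most order `p c² σ⁴ / τ²`. For `c = A k τ² / (p σ²)` this cost is the
fraction `A (σ / τ)²` of the gain, up to a constant, so it vanishes as `τ / σ → ∞`, and the gain is
eventually at least `A` times that of ridge, for every `A`.
-/

theorem integrable_pow_gaussianReal (μ : ℝ) (v : ℝ≥0) (q : ℕ) :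
    Integrable (fun x : ℝ => x ^ q) (gaussianReal μ v) := by
  have hmem := (memLp_id_gaussianReal (μ := μ) (v := v) q).integrable_norm_pow'
  exact (integrable_norm_iff (by fun_prop)).1 (by simpa using hmem)

theorem integral_sq_gaussianReal (μ : ℝ) (v : ℝ≥0) :
    ∫ x, x ^ 2 ∂gaussianReal μ v = μ ^ 2 + v := by
  have hvariance := variance_eq_sub (memLp_id_gaussianReal (μ := μ) (v := v) 2)
  rw [variance_id_gaussianReal] at hvariance
  simp only [Pi.pow_apply, id_eq, integral_id_gaussianReal] at hvariance
  linarith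

theorem integral_pow_four_gaussianReal (v : ℝ≥0) :
    ∫ x, x ^ 4 ∂gaussianReal 0 v = 3 * (v : ℝ) ^ 2 := by
  have deriv_mul_mgf (q r : ℝ → ℝ) (hq : ∀ t, HasDerivAt q (r t - v * t * q t) t) :
      deriv (fun t => q t * Real.exp (v * t ^ 2 / 2)) =
        fun t => r t * Real.exp (v * t ^ 2 / 2) := by
    ext t
    have hexponent : HasDerivAt (fun t : ℝ => v * t ^ 2 / 2) (v * t) t := by
      convert! ((hasDerivAt_pow 2 t).const_mul (v : ℝ)).div_const 2 using 1
      ring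
    exact (((hq t).mul hexponent.exp).congr_deriv (by ring)).deriv
  calc ∫ x, x ^ 4 ∂gaussianReal 0 v
      = iteratedDeriv 4 (mgf (fun x => x) (gaussianReal 0 v)) 0 := by
        rw [iteratedDeriv_mgf_zero (by simp)]; rfl
    _ = iteratedDeriv 4 (fun t : ℝ => 1 * Real.exp (v * t ^ 2 / 2)) 0 := by
        simp [mgf_fun_id_gaussianReal]
    _ = 3 * (v : ℝ) ^ 2 := by
        simp only [iteratedDeriv_succ', iteratedDeriv_zero]
        rw [deriv_mul_mgf _ (fun t => v * t) fun t => (hasDerivAt_const t 1).congr_deriv (by ring),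
          deriv_mul_mgf _ (fun t => v + v ^ 2 * t ^ 2) fun t =>
            ((hasDerivAt_id' t).const_mul (v : ℝ)).congr_deriv (by ring),
          deriv_mul_mgf _ (fun t => 3 * v ^ 2 * t + v ^ 3 * t ^ 3) fun t =>
            (((hasDerivAt_pow 2 t).const_mul ((v : ℝ) ^ 2)).const_add (v : ℝ)).congr_deriv
              (by push_cast; ring),
          deriv_mul_mgf _ (fun t => 3 * v ^ 2 + 6 * v ^ 3 * t ^ 2 + v ^ 4 * t ^ 4) fun t =>
            (((hasDerivAt_id' t).const_mul (3 * (v : ℝ) ^ 2)).fun_add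
              ((hasDerivAt_pow 3 t).const_mul ((v : ℝ) ^ 3))).congr_deriv (by push_cast; ring)]
        simp

section PiGaussian

variable {ι : Type*} [Fintype ι]

theorem measurePreserving_sum_mul_pi_gaussianReal (v : ι → ℝ≥0) (a : ι → ℝ) :
    MeasurePreserving (fun x : ι → ℝ => ∑ i, a i * x i)
      (Measure.pi fun i => gaussianReal 0 (v i)) (gaussianReal 0 (∑ i, ‖a i‖₊ ^ 2 * v i)) := by
  refine ⟨by fun_prop, Measure.ext_of_charFun ?_⟩
  have hind : iIndepFun (fun i (x : ι → ℝ) => a i * x i)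
      (Measure.pi fun i => gaussianReal 0 (v i)) :=
    iIndepFun_pi (X := fun i x => a i * x) fun i => by fun_prop
  have hlaw (i : ι) : (Measure.pi fun i => gaussianReal 0 (v i)).map (fun x => a i * x i) =
      gaussianReal 0 (‖a i‖₊ ^ 2 * v i) := by
    convert! (gaussianReal_const_mul
      (measurePreserving_eval (fun i => gaussianReal 0 (v i)) i).hasLaw (a i)).map_eq using 2
    · simp
    · ext; simp
  rw [hind.charFun_map_fun_sum_eq_prod fun i =>
    ((measurable_pi_apply i).const_mul (a i)).aemeasurable]
  ext t
  simp only [Finset.prod_apply, hlaw, charFun_gaussianReal, ← Complex.exp_sum]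
  congr 1
  push_cast
  simp [Finset.sum_mul, Finset.sum_div]

theorem measurePreserving_eval_prodMk_sum_mul_pi_gaussianReal (v : ι → ℝ≥0) {a : ι → ℝ} {j : ι}
    (haj : a j = 0) :
    MeasurePreserving (fun x : ι → ℝ => (x j, ∑ i, a i * x i))
      (Measure.pi fun i => gaussianReal 0 (v i))
      ((gaussianReal 0 (v j)).prod (gaussianReal 0 (∑ i, ‖a i‖₊ ^ 2 * v i))) := by
  classical
  have hcoord : iIndepFun (fun i (x : ι → ℝ) => x i) (Measure.pi fun i => gaussianReal 0 (v i)) :=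
    iIndepFun_pi (X := fun _ x => x) fun i => by fun_prop
  have hindep : IndepFun (fun x : ι → ℝ => x j) (fun x => ∑ i, a i * x i)
      (Measure.pi fun i => gaussianReal 0 (v i)) := by
    have hcoeff : Measurable fun y : ↥(Finset.univ.erase j) → ℝ =>
        ∑ i : ↥(Finset.univ.erase j), a i * y i := by fun_prop
    have hfin := (hcoord.indepFun_finset {j} (Finset.univ.erase j) (by simp)
      fun i => by fun_prop).comp (measurable_pi_apply ⟨j, Finset.mem_singleton_self j⟩) hcoeff
    convert! hfin using 1
    ext x
    simp only [Function.comp_apply]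
    rw [Finset.sum_coe_sort (Finset.univ.erase j) fun i => a i * x i,
      Finset.sum_erase _ (by simp [haj])]
  exact (hindep.hasLaw_prod (measurePreserving_eval _ j).hasLaw
    (measurePreserving_sum_mul_pi_gaussianReal v a).hasLaw).measurePreserving (by fun_prop)

theorem measurePreserving_eval_prodMk_sum_mul_add_mul_gaussianReal (v : ι → ℝ≥0) (w : ℝ≥0)
    {a : ι → ℝ} (b : ℝ) {j : ι} (haj : a j = 0) :
    MeasurePreserving (fun x : (ι → ℝ) × ℝ => (x.1 j, ∑ i, a i * x.1 i + b * x.2))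
      ((Measure.pi fun i => gaussianReal 0 (v i)).prod (gaussianReal 0 w))
      ((gaussianReal 0 (v j)).prod (gaussianReal 0 (∑ i, ‖a i‖₊ ^ 2 * v i + ‖b‖₊ ^ 2 * w))) := by
  have hscale : MeasurePreserving (fun x => b * x) (gaussianReal 0 w)
      (gaussianReal 0 (‖b‖₊ ^ 2 * w)) := by
    refine ⟨by fun_prop, ?_⟩
    rw [gaussianReal_map_const_mul, mul_zero]
    congr 2
    exact NNReal.eq (by simp)
  have hadd : MeasurePreserving (fun x : ℝ × ℝ => x.1 + x.2)
      ((gaussianReal 0 (∑ i, ‖a i‖₊ ^ 2 * v i)).prod (gaussianReal 0 (‖b‖₊ ^ 2 * w)))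
      (gaussianReal 0 (∑ i, ‖a i‖₊ ^ 2 * v i + ‖b‖₊ ^ 2 * w)) :=
    ⟨by fun_prop, gaussianReal_conv_gaussianReal.trans (by rw [add_zero])⟩
  exact (((MeasurePreserving.id _).prod hadd).comp (measurePreserving_prodAssoc _ _ _)).comp
    ((measurePreserving_eval_prodMk_sum_mul_pi_gaussianReal v haj).prod hscale)

theorem integrable_sum_sq_pi_gaussianReal (v : ι → ℝ≥0) :
    Integrable (fun x : ι → ℝ => ∑ i, x i ^ 2) (Measure.pi fun i => gaussianReal 0 (v i)) :=
  integrable_finsetSum _ fun i _ =>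
    integrable_comp_eval (μ := fun i => gaussianReal 0 (v i))
      (integrable_pow_gaussianReal 0 (v i) 2)

theorem integral_sum_sq_pi_gaussianReal (v : ι → ℝ≥0) :
    ∫ x : ι → ℝ, ∑ i, x i ^ 2 ∂Measure.pi (fun i => gaussianReal 0 (v i)) = ∑ i, (v i : ℝ) := by
  rw [integral_finsetSum _ fun i _ => integrable_comp_eval
    (μ := fun i => gaussianReal 0 (v i)) (integrable_pow_gaussianReal 0 (v i) 2)]
  refine Finset.sum_congr rfl fun i _ => ?_
  rw [integral_comp_eval (μ := fun i => gaussianReal 0 (v i)) (f := fun x => x ^ 2) (by fun_prop),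
    integral_sq_gaussianReal, zero_pow two_ne_zero, zero_add]

theorem integrable_sum_pow_four_pi_gaussianReal (v : ι → ℝ≥0) :
    Integrable (fun x : ι → ℝ => ∑ i, x i ^ 4) (Measure.pi fun i => gaussianReal 0 (v i)) :=
  integrable_finsetSum _ fun i _ =>
    integrable_comp_eval (μ := fun i => gaussianReal 0 (v i))
      (integrable_pow_gaussianReal 0 (v i) 4)

theorem sq_sum_sq_le_card_mul_sum_pow_four (x : ι → ℝ) :
    (∑ i, x i ^ 2) ^ 2 ≤ Fintype.card ι * ∑ i, x i ^ 4 := by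
  have hcauchySchwarz := sq_sum_le_card_mul_sum_sq (s := Finset.univ) (f := fun i => x i ^ 2)
  simp only [← pow_mul, Nat.reduceMul] at hcauchySchwarz
  exact hcauchySchwarz

theorem integrable_sq_sum_sq_pi_gaussianReal (v : ι → ℝ≥0) :
    Integrable (fun x : ι → ℝ => (∑ i, x i ^ 2) ^ 2) (Measure.pi fun i => gaussianReal 0 (v i)) :=
  ((integrable_sum_pow_four_pi_gaussianReal v).const_mul _).mono'
    (Measurable.aestronglyMeasurable (by fun_prop)) (ae_of_all _ fun x => by
      rw [Real.norm_of_nonneg (by positivity)]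
      exact sq_sum_sq_le_card_mul_sum_pow_four x)

theorem integral_sq_sum_sq_pi_gaussianReal_le (w : ℝ≥0) :
    ∫ x : ι → ℝ, (∑ i, x i ^ 2) ^ 2 ∂Measure.pi (fun _ => gaussianReal 0 w) ≤
      3 * (Fintype.card ι * w) ^ 2 := by
  calc ∫ x : ι → ℝ, (∑ i, x i ^ 2) ^ 2 ∂Measure.pi (fun _ => gaussianReal 0 w)
      ≤ ∫ x : ι → ℝ, Fintype.card ι * ∑ i, x i ^ 4 ∂Measure.pi (fun _ => gaussianReal 0 w) :=
        integral_mono (integrable_sq_sum_sq_pi_gaussianReal _)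
          ((integrable_sum_pow_four_pi_gaussianReal _).const_mul _)
          sq_sum_sq_le_card_mul_sum_pow_four
    _ = 3 * (Fintype.card ι * w) ^ 2 := by
        rw [integral_const_mul, integral_finsetSum _ fun i _ => integrable_comp_eval
          (μ := fun _ => gaussianReal 0 w) (integrable_pow_gaussianReal 0 w 4)]
        simp only [integral_comp_eval (μ := fun _ : ι => gaussianReal 0 w) (f := fun x => x ^ 4)
          (by fun_prop), integral_pow_four_gaussianReal, Finset.sum_const, Finset.card_univ,
          nsmul_eq_mul]
        ring

theorem lintegral_sq_const_add_sum_mul_pi_gaussianReal (v : ι → ℝ≥0) (m : ℝ) (a : ι → ℝ) :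
    ∫⁻ x, ENNReal.ofReal ((m + ∑ i, a i * x i) ^ 2) ∂Measure.pi (fun i => gaussianReal 0 (v i)) =
      ENNReal.ofReal (m ^ 2 + ∑ i, a i ^ 2 * v i) := by
  have hshift : MeasurePreserving (fun s => m + s) (gaussianReal 0 (∑ i, ‖a i‖₊ ^ 2 * v i))
      (gaussianReal m (∑ i, ‖a i‖₊ ^ 2 * v i)) :=
    ⟨by fun_prop, by rw [gaussianReal_map_const_add, zero_add]⟩
  have hlaw : MeasurePreserving (fun x => m + ∑ i, a i * x i)
      (Measure.pi fun i => gaussianReal 0 (v i)) (gaussianReal m (∑ i, ‖a i‖₊ ^ 2 * v i)) :=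
    hshift.comp (measurePreserving_sum_mul_pi_gaussianReal v a)
  rw [hlaw.lintegral_comp (f := fun s => ENNReal.ofReal (s ^ 2)) (by fun_prop),
    ← ofReal_integral_eq_lintegral_ofReal (integrable_pow_gaussianReal _ _ 2)
      (ae_of_all _ fun s => sq_nonneg s),
    integral_sq_gaussianReal]
  simp

theorem lintegral_pow_four_sum_mul_pi_gaussianReal (v : ι → ℝ≥0) (a : ι → ℝ) :
    ∫⁻ x, ENNReal.ofReal ((∑ i, a i * x i) ^ 4) ∂Measure.pi (fun i => gaussianReal 0 (v i)) =
      ENNReal.ofReal (3 * (∑ i, a i ^ 2 * v i) ^ 2) := by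
  rw [(measurePreserving_sum_mul_pi_gaussianReal v a).lintegral_comp
      (f := fun s => ENNReal.ofReal (s ^ 4)) (by fun_prop),
    ← ofReal_integral_eq_lintegral_ofReal (integrable_pow_gaussianReal _ _ 4)
      (ae_of_all _ fun s => by positivity),
    integral_pow_four_gaussianReal]
  simp

end PiGaussian

/-- The variance `‖β‖² / n + σ²` of every entry of the response `y = X β + σ z`. -/
noncomputable def responseVariance {p : ℕ} (n : ℕ) (σ : ℝ) (β : EuclideanSpace ℝ (Fin p)) : ℝ≥0 :=
  ‖β‖₊ ^ 2 / n + ‖σ‖₊ ^ 2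

section Response

variable {n p : ℕ}

theorem measurable_response (σ : ℝ) (β : EuclideanSpace ℝ (Fin p)) :
    Measurable fun ω : (Fin n → Fin p → ℝ) × (Fin n → ℝ) => response σ β ω.1 ω.2 := by
  unfold response
  fun_prop

theorem response_add_single (σ : ℝ) (β : EuclideanSpace ℝ (Fin p)) (j : Fin p) (b : ℝ)
    (X : Fin n → Fin p → ℝ) (z : Fin n → ℝ) :
    response σ (β + EuclideanSpace.single j b) X z = fun i => b * X i j + response σ β X z i := by
  ext i
  simp only [response, PiLp.add_apply, PiLp.single_apply, mul_add, mul_ite, mul_zero,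
    Finset.sum_add_distrib, Finset.sum_ite_eq', Finset.mem_univ, ↓reduceIte]
  ring

theorem measurePreserving_column_prodMk_response (n : ℕ) (σ : ℝ) {β : EuclideanSpace ℝ (Fin p)}
    {j : Fin p} (hβj : β j = 0) :
    MeasurePreserving
      (fun ω : (Fin n → Fin p → ℝ) × (Fin n → ℝ) => (fun i => ω.1 i j, response σ β ω.1 ω.2))
      (designNoiseLaw n p)
      ((Measure.pi fun _ : Fin n => gaussianReal 0 (n : ℝ≥0)⁻¹).prod
        (Measure.pi fun _ : Fin n => gaussianReal 0 (responseVariance n σ β))) := by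
  have hvariance : responseVariance n σ β =
      ∑ l, ‖β l‖₊ ^ 2 * (n : ℝ≥0)⁻¹ + ‖σ‖₊ ^ 2 * 1 := by
    rw [responseVariance, EuclideanSpace.nnnorm_eq, NNReal.sq_sqrt, ← Finset.sum_mul, mul_one,
      div_eq_mul_inv]
  have hrow := measurePreserving_eval_prodMk_sum_mul_add_mul_gaussianReal
    (fun _ => (n : ℝ≥0)⁻¹) 1 σ hβj
  rw [← hvariance] at hrow
  convert! ((measurePreserving_arrowProdEquivProdArrow _ _ _ _ _).comp
    (measurePreserving_pi _ _ fun _ : Fin n => hrow)).comp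
    (measurePreserving_arrowProdEquivProdArrow _ _ _ _ _).symm using 1
  ext ω i
  · rfl
  · exact congrArg (· + σ * ω.2 i) (Finset.sum_congr rfl fun l _ => mul_comm _ _)

end Response

/-- Hard thresholding at level `t`: keep `u` when `|u| > t` and replace it by `0` otherwise. -/
noncomputable def hardThreshold (t u : ℝ) : ℝ := if t < |u| then u else 0

section HardThreshold

variable {t : ℝ}

@[fun_prop]
theorem measurable_hardThreshold (t : ℝ) : Measurable (hardThreshold t) :=
  Measurable.ite (measurableSet_lt measurable_const (by fun_prop)) measurable_id measurable_const

theorem sq_mul_hardThreshold_sub_le (ht : 0 ≤ t) {c : ℝ} (hc : 0 ≤ c) (b u : ℝ) :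
    (c * hardThreshold t u - b) ^ 2 ≤ (b - c * u) ^ 2 + 2 * c * |b| * t := by
  unfold hardThreshold
  split_ifs with hu
  · nlinarith [mul_nonneg (mul_nonneg hc (abs_nonneg b)) ht]
  · have hcross : b * u ≤ |b| * t :=
      (le_abs_self _).trans ((abs_mul b u).trans_le (by gcongr; exact not_lt.1 hu))
    nlinarith [mul_le_mul_of_nonneg_left hcross hc, sq_nonneg (c * u)]

theorem hardThreshold_sq_le (ht : 0 < t) (u : ℝ) : hardThreshold t u ^ 2 ≤ u ^ 4 / t ^ 2 := by
  unfold hardThreshold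
  split_ifs with hu
  · rw [le_div_iff₀ (by positivity)]
    have htu : t ^ 2 ≤ u ^ 2 := sq_le_sq.2 ((abs_of_pos ht).trans_le hu.le)
    nlinarith [sq_nonneg u]
  · rw [zero_pow two_ne_zero]
    positivity

end HardThreshold

theorem lintegral_prod_le_ofReal_integral {α β : Type*} {_ : MeasurableSpace α}
    {_ : MeasurableSpace β} {μ : Measure α} {ν : Measure β} {f : α × β → ℝ≥0∞} {F : α → ℝ}
    (hF : Integrable F μ) (hF_nonneg : ∀ a, 0 ≤ F a)
    (hf : ∀ a, ∫⁻ b, f (a, b) ∂ν ≤ ENNReal.ofReal (F a)) :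
    ∫⁻ q, f q ∂μ.prod ν ≤ ENNReal.ofReal (∫ a, F a ∂μ) := by
  rw [ofReal_integral_eq_lintegral_ofReal hF (ae_of_all _ hF_nonneg)]
  exact (lintegral_prod_le _).trans (lintegral_mono hf)

theorem lintegral_sq_mul_hardThreshold_sub_le {ι : Type*} [Fintype ι] (v : ℝ≥0) (a : ι → ℝ)
    (b : ℝ) {c t : ℝ} (hc : 0 ≤ c) (ht : 0 ≤ t) :
    ∫⁻ r, ENNReal.ofReal ((c * hardThreshold t (∑ i, a i * (b * a i + r i)) - b) ^ 2)
        ∂Measure.pi (fun _ => gaussianReal 0 v) ≤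
      ENNReal.ofReal ((b - c * b * ∑ i, a i ^ 2) ^ 2 + c ^ 2 * v * ∑ i, a i ^ 2 +
        2 * c * |b| * t) := by
  have hresidual (r : ι → ℝ) : b - c * ∑ i, a i * (b * a i + r i) =
      (b - c * b * ∑ i, a i ^ 2) + ∑ i, (-c * a i) * r i := by
    simp only [Finset.mul_sum, sub_add, ← Finset.sum_sub_distrib]
    congr! 2
    ring
  calc ∫⁻ r, ENNReal.ofReal ((c * hardThreshold t (∑ i, a i * (b * a i + r i)) - b) ^ 2)
        ∂Measure.pi (fun _ => gaussianReal 0 v)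
      ≤ ∫⁻ r, (ENNReal.ofReal (((b - c * b * ∑ i, a i ^ 2) + ∑ i, (-c * a i) * r i) ^ 2) +
          ENNReal.ofReal (2 * c * |b| * t)) ∂Measure.pi (fun _ => gaussianReal 0 v) :=
        lintegral_mono fun r => by
          rw [← hresidual, ← ENNReal.ofReal_add (by positivity) (by positivity)]
          exact ENNReal.ofReal_le_ofReal (sq_mul_hardThreshold_sub_le ht hc b _)
    _ = ENNReal.ofReal ((b - c * b * ∑ i, a i ^ 2) ^ 2 + c ^ 2 * v * ∑ i, a i ^ 2 +
          2 * c * |b| * t) := by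
        rw [lintegral_add_right _ measurable_const,
          lintegral_sq_const_add_sum_mul_pi_gaussianReal (fun _ => v), lintegral_const,
          measure_univ, mul_one, ← ENNReal.ofReal_add (by positivity) (by positivity),
          Finset.mul_sum _ _ (c ^ 2 * (v : ℝ))]
        congr! 4
        ring

theorem lintegral_sq_mul_hardThreshold_null_le {ι : Type*} [Fintype ι] (v : ℝ≥0) (a : ι → ℝ)
    (c : ℝ) {t : ℝ} (ht : 0 < t) :
    ∫⁻ r, ENNReal.ofReal ((c * hardThreshold t (∑ i, a i * r i)) ^ 2)
        ∂Measure.pi (fun _ => gaussianReal 0 v) ≤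
      ENNReal.ofReal (3 * c ^ 2 * v ^ 2 / t ^ 2 * (∑ i, a i ^ 2) ^ 2) := by
  have hpointwise (u : ℝ) : (c * hardThreshold t u) ^ 2 ≤ c ^ 2 / t ^ 2 * u ^ 4 := by
    rw [mul_pow, div_mul_eq_mul_div, mul_div_assoc]
    exact mul_le_mul_of_nonneg_left (hardThreshold_sq_le ht u) (sq_nonneg c)
  calc ∫⁻ r, ENNReal.ofReal ((c * hardThreshold t (∑ i, a i * r i)) ^ 2)
        ∂Measure.pi (fun _ => gaussianReal 0 v)
      ≤ ∫⁻ r, ENNReal.ofReal (c ^ 2 / t ^ 2) * ENNReal.ofReal ((∑ i, a i * r i) ^ 4)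
          ∂Measure.pi (fun _ => gaussianReal 0 v) :=
        lintegral_mono fun r => by
          rw [← ENNReal.ofReal_mul (by positivity)]
          exact ENNReal.ofReal_le_ofReal (hpointwise _)
    _ = ENNReal.ofReal (3 * c ^ 2 * v ^ 2 / t ^ 2 * (∑ i, a i ^ 2) ^ 2) := by
        rw [lintegral_const_mul _ (by fun_prop),
          lintegral_pow_four_sum_mul_pi_gaussianReal (fun _ => v),
          ← ENNReal.ofReal_mul (by positivity), ← Finset.sum_mul]
        congr 1
        ring

section Column

variable {n : ℕ}

theorem integral_sum_sq_column (hn : 0 < n) :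
    ∫ a : Fin n → ℝ, ∑ i, a i ^ 2 ∂Measure.pi (fun _ => gaussianReal 0 (n : ℝ≥0)⁻¹) = 1 := by
  rw [integral_sum_sq_pi_gaussianReal fun _ : Fin n => (n : ℝ≥0)⁻¹]
  simp [hn.ne']

theorem integral_sq_sum_sq_column_le :
    ∫ a : Fin n → ℝ, (∑ i, a i ^ 2) ^ 2 ∂Measure.pi (fun _ => gaussianReal 0 (n : ℝ≥0)⁻¹) ≤ 3 := by
  refine (integral_sq_sum_sq_pi_gaussianReal_le (ι := Fin n) (n : ℝ≥0)⁻¹).trans ?_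
  have hn : |(n : ℝ) * (n : ℝ)⁻¹| ≤ 1 := by
    rw [abs_of_nonneg (by positivity)]
    exact mul_inv_le_one
  simpa using (sq_le_one_iff_abs_le_one _).2 hn

theorem lintegral_sq_mul_hardThreshold_sub_column_le (hn : 0 < n) (v : ℝ≥0) (b : ℝ) {c t : ℝ}
    (hc : 0 ≤ c) (ht : 0 ≤ t) :
    ∫⁻ q, ENNReal.ofReal ((c * hardThreshold t (∑ i, q.1 i * (b * q.1 i + q.2 i)) - b) ^ 2)
        ∂(Measure.pi fun _ : Fin n => gaussianReal 0 (n : ℝ≥0)⁻¹).prod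
          (Measure.pi fun _ : Fin n => gaussianReal 0 v) ≤
      ENNReal.ofReal (b ^ 2 * (1 - 2 * c + 3 * c ^ 2) + c ^ 2 * v + 2 * c * |b| * t) := by
  have hA := integrable_sum_sq_pi_gaussianReal fun _ : Fin n => (n : ℝ≥0)⁻¹
  have hAA := integrable_sq_sum_sq_pi_gaussianReal fun _ : Fin n => (n : ℝ≥0)⁻¹
  have hexpand (a : Fin n → ℝ) :
      (b - c * b * ∑ i, a i ^ 2) ^ 2 + c ^ 2 * v * ∑ i, a i ^ 2 + 2 * c * |b| * t =
        c ^ 2 * b ^ 2 * (∑ i, a i ^ 2) ^ 2 + ((c ^ 2 * v - 2 * c * b ^ 2) * ∑ i, a i ^ 2 +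
          (b ^ 2 + 2 * c * |b| * t)) := by ring
  have hlinear := (hA.const_mul (c ^ 2 * v - 2 * c * b ^ 2)).fun_add
    (integrable_const (b ^ 2 + 2 * c * |b| * t))
  refine (lintegral_prod_le_ofReal_integral ?_ (fun a => by positivity) fun a =>
    lintegral_sq_mul_hardThreshold_sub_le v a b hc ht).trans (ENNReal.ofReal_le_ofReal ?_)
  · simpa only [hexpand] using (hAA.const_mul _).fun_add hlinear
  · simp only [hexpand]
    rw [integral_add (hAA.const_mul _) hlinear, integral_add (hA.const_mul _) (integrable_const _),
      integral_const_mul, integral_const_mul, integral_sum_sq_column hn, integral_const,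
      probReal_univ, one_smul]
    linarith [mul_le_mul_of_nonneg_left (integral_sq_sum_sq_column_le (n := n))
      (by positivity : 0 ≤ c ^ 2 * b ^ 2)]

theorem lintegral_sq_mul_hardThreshold_null_column_le (v : ℝ≥0) (c : ℝ) {t : ℝ} (ht : 0 < t) :
    ∫⁻ q, ENNReal.ofReal ((c * hardThreshold t (∑ i, q.1 i * q.2 i)) ^ 2)
        ∂(Measure.pi fun _ : Fin n => gaussianReal 0 (n : ℝ≥0)⁻¹).prod
          (Measure.pi fun _ : Fin n => gaussianReal 0 v) ≤
      ENNReal.ofReal (9 * c ^ 2 * v ^ 2 / t ^ 2) := by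
  refine (lintegral_prod_le_ofReal_integral
    ((integrable_sq_sum_sq_pi_gaussianReal _).const_mul _) (fun a => by positivity)
    fun a => lintegral_sq_mul_hardThreshold_null_le v a c ht).trans (ENNReal.ofReal_le_ofReal ?_)
  rw [integral_const_mul]
  calc 3 * c ^ 2 * (v : ℝ) ^ 2 / t ^ 2 * ∫ a : Fin n → ℝ, (∑ i, a i ^ 2) ^ 2
          ∂Measure.pi (fun _ => gaussianReal 0 (n : ℝ≥0)⁻¹)
      ≤ 3 * c ^ 2 * (v : ℝ) ^ 2 / t ^ 2 * 3 :=
        mul_le_mul_of_nonneg_left integral_sq_sum_sq_column_le (by positivity)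
    _ = 9 * c ^ 2 * v ^ 2 / t ^ 2 := by ring

end Column

/-- The separable estimator `c · hardThreshold t (Xᵀ y)`, which shrinks the thresholded marginal
regression coefficients by `c`. -/
noncomputable def thresholdEstimator {n p : ℕ} (c t : ℝ)
    (data : (Fin n → Fin p → ℝ) × (Fin n → ℝ)) : EuclideanSpace ℝ (Fin p) :=
  WithLp.toLp 2 fun j => c * hardThreshold t (∑ i, data.1 i j * data.2 i)

section Threshold

variable {n p : ℕ}

theorem measurable_thresholdEstimator (c t : ℝ) :
    Measurable (thresholdEstimator (n := n) (p := p) c t) :=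
  (WithLp.measurable_toLp 2 (Fin p → ℝ)).comp (measurable_pi_lambda _ fun j => by fun_prop)

theorem lintegral_thresholdEstimator_coord (σ c t : ℝ) (β : EuclideanSpace ℝ (Fin p)) (j : Fin p) :
    ∫⁻ ω, ENNReal.ofReal ((thresholdEstimator c t (ω.1, response σ β ω.1 ω.2) j - β j) ^ 2)
        ∂designNoiseLaw n p =
      ∫⁻ q, ENNReal.ofReal ((c * hardThreshold t (∑ i, q.1 i * (β j * q.1 i + q.2 i)) - β j) ^ 2)
        ∂(Measure.pi fun _ : Fin n => gaussianReal 0 (n : ℝ≥0)⁻¹).prod (Measure.pi fun _ : Fin n =>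
          gaussianReal 0 (responseVariance n σ (β - EuclideanSpace.single j (β j)))) := by
  have hresponse := response_add_single (n := n) σ (β - EuclideanSpace.single j (β j)) j (β j)
  rw [sub_add_cancel] at hresponse
  rw [← (measurePreserving_column_prodMk_response n σ (j := j) (by simp)).lintegral_comp
    (by fun_prop)]
  simp only [thresholdEstimator, hresponse]

theorem responseVariance_sub_single_le (n : ℕ) (σ : ℝ) (β : EuclideanSpace ℝ (Fin p)) (j : Fin p) :
    (responseVariance n σ (β - EuclideanSpace.single j (β j)) : ℝ) ≤ ‖β‖ ^ 2 / n + σ ^ 2 := by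
  have hnorm : ‖β - EuclideanSpace.single j (β j)‖ ^ 2 ≤ ‖β‖ ^ 2 := by
    simp only [EuclideanSpace.real_norm_sq_eq]
    refine Finset.sum_le_sum fun l _ => ?_
    by_cases hl : l = j <;> simp [hl, sq_nonneg]
  simp only [responseVariance, NNReal.coe_add, NNReal.coe_div, NNReal.coe_pow, coe_nnnorm,
    NNReal.coe_natCast, Real.norm_eq_abs, sq_abs]
  gcongr

theorem lintegral_thresholdEstimator_coord_le (hn : 0 < n) {σ c τ V : ℝ} (hc : 0 ≤ c)
    (hτ : 0 < τ) {β : EuclideanSpace ℝ (Fin p)} (hV : ‖β‖ ^ 2 / n + σ ^ 2 ≤ V) (j : Fin p) :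
    ∫⁻ ω, ENNReal.ofReal ((thresholdEstimator c (τ / 4) (ω.1, response σ β ω.1 ω.2) j - β j) ^ 2)
        ∂designNoiseLaw n p ≤
      ENNReal.ofReal (β j ^ 2 * (1 - 7 / 4 * c + 3 * c ^ 2) +
        (if β j ≠ 0 then c * τ ^ 2 / 4 + c ^ 2 * V else 0) + 144 * c ^ 2 * V ^ 2 / τ ^ 2) := by
  rw [lintegral_thresholdEstimator_coord]
  set v := responseVariance n σ (β - EuclideanSpace.single j (β j))
  have hv : (v : ℝ) ≤ V := (responseVariance_sub_single_le n σ β j).trans hV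
  by_cases hb : β j = 0
  · simp only [hb, zero_mul, zero_add, sub_zero]
    refine (lintegral_sq_mul_hardThreshold_null_column_le v c (by positivity)).trans
      (ENNReal.ofReal_le_ofReal ?_)
    calc 9 * c ^ 2 * (v : ℝ) ^ 2 / (τ / 4) ^ 2 = 144 * c ^ 2 * (v : ℝ) ^ 2 / τ ^ 2 := by
          field_simp; ring
      _ ≤ 144 * c ^ 2 * V ^ 2 / τ ^ 2 := by gcongr
      _ = _ := by simp
  · refine (lintegral_sq_mul_hardThreshold_sub_column_le hn v (β j) hc (by positivity)).trans
      (ENNReal.ofReal_le_ofReal ?_)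
    have hyoung : 2 * |β j| * τ ≤ β j ^ 2 + τ ^ 2 := sq_abs (β j) ▸ two_mul_le_add_sq _ _
    have hnull : 0 ≤ 144 * c ^ 2 * V ^ 2 / τ ^ 2 := by positivity
    rw [if_pos hb]
    linarith [mul_le_mul_of_nonneg_left hyoung hc, mul_le_mul_of_nonneg_left hv (sq_nonneg c)]

theorem risk_eq_sum_lintegral (σ : ℝ)
    {est : (Fin n → Fin p → ℝ) × (Fin n → ℝ) → EuclideanSpace ℝ (Fin p)} (hest : Measurable est)
    (β : EuclideanSpace ℝ (Fin p)) :
    risk σ est β = ∑ j, ∫⁻ ω, ENNReal.ofReal ((est (ω.1, response σ β ω.1 ω.2) j - β j) ^ 2)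
      ∂designNoiseLaw n p := by
  have hmeas := hest.comp (measurable_fst.prodMk (measurable_response (n := n) σ β))
  have hcoord (j : Fin p) : Measurable fun ω : (Fin n → Fin p → ℝ) × (Fin n → ℝ) =>
      est (ω.1, response σ β ω.1 ω.2) j :=
    (measurable_pi_apply j).comp ((WithLp.measurable_ofLp 2 _).comp hmeas)
  simp only [risk, EuclideanSpace.real_norm_sq_eq, PiLp.sub_apply,
    ENNReal.ofReal_sum_of_nonneg fun _ _ => sq_nonneg _]
  exact lintegral_finsetSum _ fun j _ => (((hcoord j).sub_const _).pow_const 2).ennreal_ofReal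

theorem risk_thresholdEstimator_le {k : ℕ} (hn : 0 < n) {σ c τ V : ℝ} (hc : 0 ≤ c) (hτ : 0 < τ)
    (hV : k * τ ^ 2 / n + σ ^ 2 ≤ V) {β : EuclideanSpace ℝ (Fin p)} (hβ : β ∈ paramSpace p k τ) :
    risk (n := n) σ (thresholdEstimator c (τ / 4)) β ≤
      ENNReal.ofReal (k * τ ^ 2 * (1 - 3 / 2 * c + 3 * c ^ 2) + k * c ^ 2 * V +
        144 * p * c ^ 2 * V ^ 2 / τ ^ 2) := by
  obtain ⟨hsparse, hnorm⟩ := hβ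
  have hVβ : ‖β‖ ^ 2 / n + σ ^ 2 ≤ V := le_trans (by gcongr) hV
  have hshrink : 0 ≤ 1 - 7 / 4 * c + 3 * c ^ 2 := by nlinarith [sq_nonneg (c - 7 / 24)]
  have hV0 : 0 ≤ V := le_trans (by positivity) hV
  have hcard : ((Finset.univ.filter fun j => β j ≠ 0).card : ℝ) ≤ k := by
    rw [Set.ncard_eq_toFinset_card'] at hsparse
    simp only [Set.toFinset_ofPred] at hsparse
    exact_mod_cast hsparse
  rw [risk_eq_sum_lintegral σ (measurable_thresholdEstimator c (τ / 4))]
  refine (Finset.sum_le_sum fun j _ =>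
    lintegral_thresholdEstimator_coord_le hn hc hτ hVβ j).trans ?_
  rw [← ENNReal.ofReal_sum_of_nonneg fun j _ => by positivity]
  refine ENNReal.ofReal_le_ofReal ?_
  rw [Finset.sum_add_distrib, Finset.sum_add_distrib, ← Finset.sum_mul,
    ← EuclideanSpace.real_norm_sq_eq, ← Finset.sum_filter, Finset.sum_const, Finset.sum_const,
    Finset.card_univ, Fintype.card_fin, nsmul_eq_mul, nsmul_eq_mul]
  calc ‖β‖ ^ 2 * (1 - 7 / 4 * c + 3 * c ^ 2) +
        (Finset.univ.filter fun j => β j ≠ 0).card * (c * τ ^ 2 / 4 + c ^ 2 * V) +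
        p * (144 * c ^ 2 * V ^ 2 / τ ^ 2)
      ≤ k * τ ^ 2 * (1 - 7 / 4 * c + 3 * c ^ 2) + k * (c * τ ^ 2 / 4 + c ^ 2 * V) +
        p * (144 * c ^ 2 * V ^ 2 / τ ^ 2) := by gcongr
    _ = k * τ ^ 2 * (1 - 3 / 2 * c + 3 * c ^ 2) + k * c ^ 2 * V +
        144 * p * c ^ 2 * V ^ 2 / τ ^ 2 := by ring

theorem toReal_sparseMinimaxRisk_le {k : ℕ} (hn : 0 < n) (hk : 0 < k) {σ c τ V : ℝ} (hc : 0 ≤ c)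
    (hτ : 0 < τ) (hV : k * τ ^ 2 / n + σ ^ 2 ≤ V)
    (hsmall : c * (3 + V / τ ^ 2 + 144 * (p / k) * (V ^ 2 / τ ^ 4)) ≤ 1 / 2) :
    (sparseMinimaxRisk n p k τ σ).toReal ≤ k * τ ^ 2 * (1 - c) := by
  have hbound : sparseMinimaxRisk n p k τ σ ≤
      ENNReal.ofReal (k * τ ^ 2 * (1 - 3 / 2 * c + 3 * c ^ 2) + k * c ^ 2 * V +
        144 * p * c ^ 2 * V ^ 2 / τ ^ 2) :=
    iInf₂_le_of_le _ (measurable_thresholdEstimator c (τ / 4))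
      (iSup₂_le fun _ hβ => risk_thresholdEstimator_le hn hc hτ hV hβ)
  have hV0 : 0 ≤ V := le_trans (by positivity) hV
  have hshrink : 0 ≤ 1 - 3 / 2 * c + 3 * c ^ 2 := by nlinarith [sq_nonneg (c - 1 / 4)]
  calc (sparseMinimaxRisk n p k τ σ).toReal
      ≤ k * τ ^ 2 * (1 - 3 / 2 * c + 3 * c ^ 2) + k * c ^ 2 * V +
        144 * p * c ^ 2 * V ^ 2 / τ ^ 2 := ENNReal.toReal_le_of_le_ofReal (by positivity) hbound
    _ = k * τ ^ 2 * (1 - 3 / 2 * c +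
        c * (c * (3 + V / τ ^ 2 + 144 * (p / k) * (V ^ 2 / τ ^ 4)))) := by
        field_simp; ring
    _ ≤ k * τ ^ 2 * (1 - 3 / 2 * c + c * (1 / 2)) := by gcongr
    _ = k * τ ^ 2 * (1 - c) := by ring

end Threshold

/-- The law of the design matrix `X`, the first marginal of `designNoiseLaw`. -/
noncomputable abbrev designLaw (n p : ℕ) : Measure (Fin n → Fin p → ℝ) :=
  Measure.pi fun _ => Measure.pi fun _ => gaussianReal 0 (n : ℝ≥0)⁻¹

/-- The estimator `M X *ᵥ y`, linear in the response `y` but with an arbitrary dependence on the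
design `X`. -/
def linearEstimator {n p : ℕ} (M : (Fin n → Fin p → ℝ) → Matrix (Fin p) (Fin n) ℝ)
    (data : (Fin n → Fin p → ℝ) × (Fin n → ℝ)) : EuclideanSpace ℝ (Fin p) :=
  WithLp.toLp 2 (M data.1 *ᵥ data.2)

section LinearEstimator

variable {n p : ℕ} {M : (Fin n → Fin p → ℝ) → Matrix (Fin p) (Fin n) ℝ}

theorem measurable_linearEstimator (hM : ∀ l i, Measurable fun X => M X l i) :
    Measurable (linearEstimator M) := by
  refine (WithLp.measurable_toLp 2 (Fin p → ℝ)).comp (measurable_pi_lambda _ fun l => ?_)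
  simp only [Matrix.mulVec, dotProduct]
  have hweight (i : Fin n) : Measurable fun data : (Fin n → Fin p → ℝ) × (Fin n → ℝ) =>
      M data.1 l i := (hM l i).comp measurable_fst
  exact Finset.measurable_sum _ fun i _ => (hweight i).mul (by fun_prop)

theorem measurable_linearEstimator_bias (hM : ∀ l i, Measurable fun X => M X l i)
    (b : Fin p → ℝ) (l : Fin p) :
    Measurable fun X => ((M X * Matrix.of X - 1) *ᵥ b) l := by
  simp only [Matrix.mulVec, dotProduct, Matrix.sub_apply, Matrix.mul_apply, Matrix.of_apply]
  refine Finset.measurable_sum _ fun j _ => Measurable.mul_const (Measurable.sub_const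
    (Finset.measurable_sum _ fun i _ => (hM l i).mul ?_) _) _
  fun_prop

theorem measurable_linearEstimator_coordRisk (hM : ∀ l i, Measurable fun X => M X l i) (s : ℝ)
    (b : Fin p → ℝ) (l : Fin p) :
    Measurable fun X => ((M X * Matrix.of X - 1) *ᵥ b) l ^ 2 + s * ∑ i, M X l i ^ 2 :=
  ((measurable_linearEstimator_bias hM b l).pow_const 2).add
    ((Finset.measurable_sum _ fun i _ => (hM l i).pow_const 2).const_mul s)

theorem linearEstimator_response_apply_sub (σ : ℝ) (β : EuclideanSpace ℝ (Fin p))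
    (X : Fin n → Fin p → ℝ) (z : Fin n → ℝ) (l : Fin p) :
    linearEstimator M (X, response σ β X z) l - β l =
      ((M X * Matrix.of X - 1) *ᵥ β.ofLp) l + ∑ i, σ * M X l i * z i := by
  have hresponse : response σ β X z = Matrix.of X *ᵥ β.ofLp + σ • z := rfl
  rw [Matrix.sub_mulVec, Matrix.one_mulVec, ← Matrix.mulVec_mulVec]
  simp only [linearEstimator, hresponse, Matrix.mulVec_add, Matrix.mulVec_smul, Pi.add_apply,
    Pi.sub_apply, Pi.smul_apply, smul_eq_mul, mul_assoc, ← Finset.mul_sum]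
  rw [add_sub_right_comm]
  rfl

theorem risk_linearEstimator (hM : ∀ l i, Measurable fun X => M X l i) (σ : ℝ)
    (β : EuclideanSpace ℝ (Fin p)) :
    risk σ (linearEstimator M) β =
      ∑ l, ∫⁻ X, ENNReal.ofReal
        (((M X * Matrix.of X - 1) *ᵥ β.ofLp) l ^ 2 + σ ^ 2 * ∑ i, M X l i ^ 2)
        ∂designLaw n p := by
  rw [risk_eq_sum_lintegral σ (measurable_linearEstimator hM)]
  refine Finset.sum_congr rfl fun l _ => ?_
  simp only [linearEstimator_response_apply_sub]
  have hnoise : Measurable fun ω : (Fin n → Fin p → ℝ) × (Fin n → ℝ) =>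
      ∑ i, σ * M ω.1 l i * ω.2 i := Finset.measurable_sum _ fun i _ =>
    (((hM l i).comp measurable_fst).const_mul σ).mul (by fun_prop)
  have hbias : Measurable fun ω : (Fin n → Fin p → ℝ) × (Fin n → ℝ) =>
      ((M ω.1 * Matrix.of ω.1 - 1) *ᵥ β.ofLp) l :=
    (measurable_linearEstimator_bias hM β.ofLp l).comp measurable_fst
  have hmeas := ((hbias.fun_add hnoise).pow_const 2).ennreal_ofReal
  rw [designNoiseLaw, lintegral_prod _ hmeas.aemeasurable]
  refine lintegral_congr fun X => ?_
  refine (lintegral_sq_const_add_sum_mul_pi_gaussianReal (fun _ : Fin n => (1 : ℝ≥0))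
    (((M X * Matrix.of X - 1) *ᵥ β.ofLp) l) fun i => σ * M X l i).trans ?_
  simp only [NNReal.coe_one, mul_one, mul_pow, Finset.mul_sum]

theorem measurePreserving_design_column (n : ℕ) (j : Fin p) :
    MeasurePreserving (fun (X : Fin n → Fin p → ℝ) i => X i j) (designLaw n p)
      (Measure.pi fun _ => gaussianReal 0 (n : ℝ≥0)⁻¹) :=
  measurePreserving_pi _ _ fun _ =>
    measurePreserving_eval (fun _ : Fin p => gaussianReal 0 (n : ℝ≥0)⁻¹) j

/-- The Bayes risk of estimating a centred scalar of variance `T` from `y = θ x + noise` of variance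
`s` by `m ⬝ᵥ y` is smallest at `m = T x / (s + T ‖x‖²)`; `1 - t ≤ 1 / (1 + t)` gives this bound. -/
theorem sub_sq_div_mul_sum_sq_le {ι : Type*} [Fintype ι] (m x : ι → ℝ) {T s : ℝ} (hT : 0 ≤ T)
    (hs : 0 < s) :
    T - T ^ 2 / s * ∑ i, x i ^ 2 ≤ T * (∑ i, m i * x i - 1) ^ 2 + s * ∑ i, m i ^ 2 := by
  have hsquare : s * ∑ i, (T / s * x i - m i) ^ 2 =
      T ^ 2 / s * ∑ i, x i ^ 2 - 2 * T * ∑ i, m i * x i + s * ∑ i, m i ^ 2 := by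
    simp only [Finset.mul_sum, ← Finset.sum_sub_distrib, ← Finset.sum_add_distrib]
    exact Finset.sum_congr rfl fun i _ => by field_simp; ring
  have hnonneg : 0 ≤ s * ∑ i, (T / s * x i - m i) ^ 2 := by positivity
  nlinarith [mul_nonneg hT (sq_nonneg (∑ i, m i * x i))]

theorem ofReal_integral_le_lintegral_ofReal {Ω : Type*} {_ : MeasurableSpace Ω} {μ : Measure Ω}
    {f : Ω → ℝ} (hf : Integrable f μ) :
    ENNReal.ofReal (∫ ω, f ω ∂μ) ≤ ∫⁻ ω, ENNReal.ofReal (f ω) ∂μ := by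
  rw [integral_eq_lintegral_pos_part_sub_lintegral_neg_part hf]
  exact (ENNReal.ofReal_le_ofReal (sub_le_self _ ENNReal.toReal_nonneg)).trans
    ENNReal.ofReal_toReal_le

theorem single_mem_paramSpace {k : ℕ} (hk : 0 < k) (τ : ℝ) (j : Fin p) :
    EuclideanSpace.single j √(k * τ ^ 2) ∈ paramSpace p k τ := by
  constructor
  · refine (Set.ncard_le_ncard (t := {j}) fun l hl => ?_).trans
      ((Set.ncard_singleton j).le.trans hk)
    by_contra hlj
    exact hl (by simp [Set.mem_singleton_iff.not.1 hlj])
  · have hnonneg : (0 : ℝ) ≤ k * τ ^ 2 := by positivity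
    rw [EuclideanSpace.single, PiLp.norm_single, Real.norm_eq_abs, sq_abs, Real.sq_sqrt hnonneg]

theorem integrable_sum_sq_design_column (n : ℕ) (j : Fin p) :
    Integrable (fun X : Fin n → Fin p → ℝ => ∑ i, X i j ^ 2) (designLaw n p) :=
  (measurePreserving_design_column n j).integrable_comp_of_integrable
    (integrable_sum_sq_pi_gaussianReal fun _ : Fin n => (n : ℝ≥0)⁻¹)

theorem integral_sum_sq_design_column (hn : 0 < n) (j : Fin p) :
    ∫ X : Fin n → Fin p → ℝ, ∑ i, X i j ^ 2 ∂designLaw n p = 1 := by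
  have hcolumn := measurePreserving_design_column n j
  have hmeas : Measurable fun a : Fin n → ℝ => ∑ i, a i ^ 2 := by fun_prop
  rw [← integral_sum_sq_column hn, ← hcolumn.map_eq,
    integral_map hcolumn.measurable.aemeasurable hmeas.aestronglyMeasurable]

theorem sum_lintegral_linearEstimator_coord_ge (hn : 0 < n) (hp : 0 < p)
    (hM : ∀ l i, Measurable fun X => M X l i) {σ T : ℝ} (hσ : 0 < σ) (hT : 0 ≤ T) (l : Fin p) :
    ENNReal.ofReal (T - T ^ 2 / (p * σ ^ 2)) ≤
      ∑ j, ∫⁻ X, ENNReal.ofReal (((M X * Matrix.of X - 1) *ᵥ Pi.single j √T) l ^ 2 +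
        σ ^ 2 * ∑ i, M X l i ^ 2) ∂designLaw n p := by
  have hcolumn := (integrable_sum_sq_design_column n l).const_mul (T ^ 2 / (p * σ ^ 2))
  have hmean : ∫ X : Fin n → Fin p → ℝ, (T - T ^ 2 / (p * σ ^ 2) * ∑ i, X i l ^ 2)
      ∂designLaw n p = T - T ^ 2 / (p * σ ^ 2) := by
    rw [integral_sub (integrable_const _) hcolumn, integral_const_mul,
      integral_sum_sq_design_column hn]
    simp
  rw [← lintegral_finsetSum _ fun j _ =>
    (measurable_linearEstimator_coordRisk hM _ _ l).ennreal_ofReal, ← hmean]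
  refine (ofReal_integral_le_lintegral_ofReal ((integrable_const _).sub hcolumn)).trans
    (lintegral_mono fun X => ?_)
  rw [← ENNReal.ofReal_sum_of_nonneg fun j _ => by positivity]
  refine ENNReal.ofReal_le_ofReal ?_
  have hdiag : T * (∑ i, M X l i * X i l - 1) ^ 2 ≤
      ∑ j, ((M X * Matrix.of X - 1) *ᵥ Pi.single j √T) l ^ 2 := by
    refine le_of_eq_of_le ?_ (Finset.single_le_sum
      (f := fun j => ((M X * Matrix.of X - 1) *ᵥ Pi.single j √T) l ^ 2)
      (fun j _ => sq_nonneg _) (Finset.mem_univ l))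
    simp [Matrix.mul_apply, mul_pow, Real.sq_sqrt hT, mul_comm]
  rw [Finset.sum_add_distrib, Finset.sum_const, Finset.card_univ, Fintype.card_fin, nsmul_eq_mul,
    ← mul_assoc]
  exact (sub_sq_div_mul_sum_sq_le (M X l) (fun i => X i l) hT (by positivity)).trans
    (add_le_add_left hdiag _)

theorem supRisk_linearEstimator_ge {k : ℕ} (hn : 0 < n) (hp : 0 < p) (hk : 0 < k)
    (hM : ∀ l i, Measurable fun X => M X l i) {σ : ℝ} (hσ : 0 < σ) (τ : ℝ) :
    ENNReal.ofReal (k * τ ^ 2 - (k * τ ^ 2) ^ 2 / (p * σ ^ 2)) ≤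
      supRisk k τ σ (linearEstimator M) := by
  set T : ℝ := k * τ ^ 2
  have hp' : (p : ℝ≥0∞) ≠ 0 := by exact_mod_cast hp.ne'
  refine (ENNReal.mul_le_mul_iff_right hp' (ENNReal.natCast_ne_top p)).1 ?_
  calc p * ENNReal.ofReal (T - T ^ 2 / (p * σ ^ 2))
      = ∑ _l : Fin p, ENNReal.ofReal (T - T ^ 2 / (p * σ ^ 2)) := by simp
    _ ≤ ∑ l, ∑ j, ∫⁻ X, ENNReal.ofReal (((M X * Matrix.of X - 1) *ᵥ Pi.single j √T) l ^ 2 +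
          σ ^ 2 * ∑ i, M X l i ^ 2) ∂designLaw n p := Finset.sum_le_sum fun l _ =>
        sum_lintegral_linearEstimator_coord_ge hn hp hM hσ (by positivity) l
    _ = ∑ j, risk σ (linearEstimator M) (EuclideanSpace.single j √T) := by
        rw [Finset.sum_comm]
        simp only [risk_linearEstimator hM, EuclideanSpace.single, PiLp.ofLp_single]
    _ ≤ ∑ _j : Fin p, supRisk k τ σ (linearEstimator M) := Finset.sum_le_sum fun j _ =>
        le_iSup₂ (f := fun β (_ : β ∈ paramSpace p k τ) => risk σ (linearEstimator M) β) _
          (single_mem_paramSpace hk τ j)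
    _ = p * supRisk k τ σ (linearEstimator M) := by simp

end LinearEstimator

/-- The matrix `(XᵀX + lam I)⁻¹ Xᵀ` mapping the response to the ridge estimate. -/
noncomputable def ridgeMatrix {n p : ℕ} (lam : ℝ) (X : Matrix (Fin n) (Fin p) ℝ) :
    Matrix (Fin p) (Fin n) ℝ :=
  (Xᵀ * X + lam • (1 : Matrix (Fin p) (Fin p) ℝ))⁻¹ * Xᵀ

section Ridge

variable {n p : ℕ}

theorem measurable_ridgeMatrix (lam : ℝ) (l : Fin p) (i : Fin n) :
    Measurable fun X : Fin n → Fin p → ℝ => ridgeMatrix lam (Matrix.of X) l i := by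
  have hof : Continuous fun X : Fin n → Fin p → ℝ => Matrix.of X := continuous_id
  have hgram : Continuous fun X : Fin n → Fin p → ℝ =>
      (Matrix.of X)ᵀ * Matrix.of X + lam • (1 : Matrix (Fin p) (Fin p) ℝ) :=
    (hof.matrix_transpose.matrix_mul hof).add continuous_const
  have hadjugate := (hgram.matrix_adjugate.matrix_mul hof.matrix_transpose).matrix_elem l i
  convert! hgram.matrix_det.measurable.inv.mul hadjugate.measurable using 2 with X
  rw [ridgeMatrix, Matrix.inv_def, Ring.inverse_eq_inv', Matrix.smul_mul, Matrix.smul_apply,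
    smul_eq_mul]
  rfl

theorem ridgeEstimator_eq_linearEstimator {lam : ℝ} (hlam : 0 < lam) :
    ridgeEstimator (n := n) (p := p) lam =
      linearEstimator fun X => ridgeMatrix lam (Matrix.of X) := by
  ext1 ⟨X, y⟩
  exact (ridgeEstimator_eq hlam X y).trans (congrArg _ (Matrix.mulVec_mulVec _ _ _))

theorem ridgeMatrix_normal_eq {lam : ℝ} (hlam : 0 < lam) (X : Matrix (Fin n) (Fin p) ℝ) :
    (Xᵀ * X + lam • (1 : Matrix (Fin p) (Fin p) ℝ)) * ridgeMatrix lam X = Xᵀ := by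
  have hgram : (Xᵀ * X).PosSemidef := by
    simpa using Matrix.posSemidef_conjTranspose_mul_self X
  have hpos : (Xᵀ * X + lam • (1 : Matrix (Fin p) (Fin p) ℝ)).PosDef :=
    Matrix.PosDef.posSemidef_add hgram (Matrix.PosDef.one.smul hlam)
  rw [ridgeMatrix, Matrix.mul_nonsing_inv_cancel_left _ _
    ((Matrix.isUnit_iff_isUnit_det _).1 hpos.isUnit)]

theorem dotProduct_regularizedGram_mulVec (lam : ℝ) (X : Matrix (Fin n) (Fin p) ℝ)
    (v : Fin p → ℝ) :
    v ⬝ᵥ ((Xᵀ * X + lam • (1 : Matrix (Fin p) (Fin p) ℝ)) *ᵥ v) =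
      (X *ᵥ v) ⬝ᵥ (X *ᵥ v) + lam * (v ⬝ᵥ v) := by
  rw [Matrix.add_mulVec, dotProduct_add, Matrix.smul_mulVec, Matrix.one_mulVec, dotProduct_smul,
    ← Matrix.mulVec_mulVec, Matrix.mulVec_transpose, dotProduct_comm v, ← Matrix.dotProduct_mulVec,
    smul_eq_mul]

theorem sum_ridgeMatrix_col_sq_le {lam : ℝ} (hlam : 0 < lam) (X : Matrix (Fin n) (Fin p) ℝ)
    (i : Fin n) : ∑ l, ridgeMatrix lam X l i ^ 2 ≤ 1 / (4 * lam) := by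
  set h : Fin p → ℝ := fun l => ridgeMatrix lam X l i with hcol
  have hnormal : (Xᵀ * X + lam • (1 : Matrix (Fin p) (Fin p) ℝ)) *ᵥ h = X i := by
    have hsingle : h = ridgeMatrix lam X *ᵥ Pi.single i 1 := by
      ext l
      simp [hcol]
    rw [hsingle, Matrix.mulVec_mulVec, ridgeMatrix_normal_eq hlam]
    ext j
    simp
  have henergy := dotProduct_regularizedGram_mulVec lam X h
  rw [hnormal, dotProduct_comm] at henergy
  have hentry : (X *ᵥ h) i * (X *ᵥ h) i ≤ (X *ᵥ h) ⬝ᵥ (X *ᵥ h) :=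
    Finset.single_le_sum (f := fun i => (X *ᵥ h) i * (X *ᵥ h) i)
      (fun _ _ => mul_self_nonneg _) (Finset.mem_univ i)
  have hfitted : X i ⬝ᵥ h = (X *ᵥ h) i := rfl
  have hnorm : h ⬝ᵥ h = ∑ l, ridgeMatrix lam X l i ^ 2 :=
    Finset.sum_congr rfl fun l _ => (pow_two _).symm
  rw [← hnorm, le_div_iff₀ (by positivity)]
  nlinarith [sq_nonneg ((X *ᵥ h) i - 1 / 2)]

theorem sum_ridge_bias_sq_le {lam : ℝ} (hlam : 0 < lam) (X : Matrix (Fin n) (Fin p) ℝ)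
    (b : Fin p → ℝ) : ∑ l, ((ridgeMatrix lam X * X - 1) *ᵥ b) l ^ 2 ≤ ∑ l, b l ^ 2 := by
  set w := (ridgeMatrix lam X * X - 1) *ᵥ b with hw
  have hnormal : (Xᵀ * X + lam • (1 : Matrix (Fin p) (Fin p) ℝ)) *ᵥ w = -(lam • b) := by
    rw [hw, Matrix.mulVec_mulVec, Matrix.mul_sub, ← Matrix.mul_assoc,
      ridgeMatrix_normal_eq hlam, Matrix.mul_one,
      sub_add_cancel_left, Matrix.neg_mulVec, Matrix.smul_mulVec, Matrix.one_mulVec]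
  have henergy := dotProduct_regularizedGram_mulVec lam X w
  rw [hnormal, dotProduct_neg, dotProduct_smul, smul_eq_mul] at henergy
  have hfitted : 0 ≤ (X *ᵥ w) ⬝ᵥ (X *ᵥ w) := Finset.sum_nonneg fun i _ => mul_self_nonneg _
  have hcontract : w ⬝ᵥ w ≤ -(w ⬝ᵥ b) := le_of_mul_le_mul_left (by linarith) hlam
  have hyoung : -2 * (w ⬝ᵥ b) ≤ w ⬝ᵥ w + b ⬝ᵥ b := by
    simp only [dotProduct, Finset.mul_sum, ← Finset.sum_add_distrib]
    exact Finset.sum_le_sum fun l _ => by nlinarith [sq_nonneg (w l + b l)]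
  have hsq (v : Fin p → ℝ) : ∑ l, v l ^ 2 = v ⬝ᵥ v := Finset.sum_congr rfl fun l _ => pow_two _
  rw [hsq, hsq]
  linarith

theorem risk_ridgeEstimator_le {lam : ℝ} (hlam : 0 < lam) (σ : ℝ) (β : EuclideanSpace ℝ (Fin p)) :
    risk (n := n) σ (ridgeEstimator lam) β ≤
      ENNReal.ofReal (‖β‖ ^ 2 + σ ^ 2 * n / (4 * lam)) := by
  have hM := measurable_ridgeMatrix (n := n) (p := p) lam
  have hvariance (X : Fin n → Fin p → ℝ) :
      ∑ l, ∑ i, ridgeMatrix lam (Matrix.of X) l i ^ 2 ≤ n * (1 / (4 * lam)) := by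
    rw [Finset.sum_comm]
    simpa using Finset.sum_le_card_nsmul Finset.univ _ _ fun i _ =>
      sum_ridgeMatrix_col_sq_le hlam (Matrix.of X) i
  rw [ridgeEstimator_eq_linearEstimator hlam, risk_linearEstimator hM,
    ← lintegral_finsetSum _ fun l _ =>
      (measurable_linearEstimator_coordRisk hM _ _ l).ennreal_ofReal]
  refine (lintegral_mono (g := fun _ => ENNReal.ofReal (‖β‖ ^ 2 + σ ^ 2 * n / (4 * lam)))
    fun X => ?_).trans (by simp)
  rw [← ENNReal.ofReal_sum_of_nonneg fun l _ => by positivity]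
  refine ENNReal.ofReal_le_ofReal ?_
  rw [Finset.sum_add_distrib, ← Finset.mul_sum, EuclideanSpace.real_norm_sq_eq, mul_div_assoc,
    ← mul_one_div (n : ℝ)]
  exact add_le_add (sum_ridge_bias_sq_le hlam (Matrix.of X) β.ofLp)
    (mul_le_mul_of_nonneg_left (hvariance X) (sq_nonneg σ))

theorem ridgeOptimalRisk_le (n p k : ℕ) (τ σ : ℝ) :
    ridgeOptimalRisk n p k τ σ ≤ ENNReal.ofReal (k * τ ^ 2) := by
  have hbound (lam : ℝ) (hlam : 0 < lam) :
      ridgeOptimalRisk n p k τ σ ≤ ENNReal.ofReal (k * τ ^ 2 + σ ^ 2 * n / (4 * lam)) :=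
    iInf₂_le_of_le lam hlam (iSup₂_le fun β hβ => (risk_ridgeEstimator_le hlam σ β).trans
      (ENNReal.ofReal_le_ofReal (add_le_add_left hβ.2 _)))
  have hlim : Tendsto (fun lam : ℝ => ENNReal.ofReal (k * τ ^ 2 + σ ^ 2 * n / (4 * lam))) atTop
      (𝓝 (ENNReal.ofReal (k * τ ^ 2 + 0))) :=
    ENNReal.tendsto_ofReal (tendsto_const_nhds.add
      (tendsto_const_nhds.div_atTop (tendsto_id.const_mul_atTop four_pos)))
  rw [add_zero] at hlim
  exact ge_of_tendsto hlim ((eventually_gt_atTop 0).mono hbound)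

theorem toReal_ridgeOptimalRisk_le (n p k : ℕ) (τ σ : ℝ) :
    (ridgeOptimalRisk n p k τ σ).toReal ≤ k * τ ^ 2 :=
  ENNReal.toReal_le_of_le_ofReal (by positivity) (ridgeOptimalRisk_le n p k τ σ)

theorem le_toReal_ridgeOptimalRisk {k : ℕ} (hn : 0 < n) (hp : 0 < p) (hk : 0 < k) {σ : ℝ}
    (hσ : 0 < σ) (τ : ℝ) :
    k * τ ^ 2 * (1 - k * τ ^ 2 / (p * σ ^ 2)) ≤ (ridgeOptimalRisk n p k τ σ).toReal := by
  have hfinite := ((ridgeOptimalRisk_le n p k τ σ).trans_lt ENNReal.ofReal_lt_top).ne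
  refine (ENNReal.ofReal_le_iff_le_toReal hfinite).1 (le_iInf₂ fun lam hlam => ?_)
  rw [ridgeEstimator_eq_linearEstimator hlam, mul_one_sub, mul_div_assoc', ← pow_two]
  exact supRisk_linearEstimator_ge hn hp hk (measurable_ridgeMatrix lam) hσ τ

end Ridge

section Asymptotics

variable {ι : Type*} {l : Filter ι}

theorem eventually_toReal_sparseMinimaxRisk_le {n p k : ι → ℕ} {τ σ : ι → ℝ}
    (hn : ∀ m, 0 < n m) (hp : ∀ m, 0 < p m) (hk : ∀ m, 0 < k m) (hσ : ∀ m, 0 < σ m)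
    (hsnr : Tendsto (fun m => τ m / σ m) l atTop)
    (hgain : Tendsto (fun m => k m * τ m ^ 2 / (p m * σ m ^ 2)) l (𝓝 0))
    (hsample : (fun m => k m * τ m ^ 2) =O[l] fun m => n m * σ m ^ 2) {A : ℝ} (hA : 0 ≤ A) :
    ∀ᶠ m in l, (sparseMinimaxRisk (n m) (p m) (k m) (τ m) (σ m)).toReal ≤
      k m * τ m ^ 2 * (1 - A * (k m * τ m ^ 2 / (p m * σ m ^ 2))) := by
  obtain ⟨B, hB, hbound⟩ := hsample.exists_pos
  set s : ι → ℝ := fun m => k m * τ m ^ 2 / (p m * σ m ^ 2) with hs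
  have hinv : Tendsto (fun m => (τ m / σ m)⁻¹ ^ 2) l (𝓝 0) := by
    simpa using hsnr.inv_tendsto_atTop.pow 2
  have hsmall : Tendsto (fun m => A * (3 * s m + (1 + B) * (s m * (τ m / σ m)⁻¹ ^ 2) +
      144 * (1 + B) ^ 2 * (τ m / σ m)⁻¹ ^ 2)) l (𝓝 0) := by
    simpa using ((((hgain.const_mul 3).add ((hgain.mul hinv).const_mul (1 + B))).add
      (hinv.const_mul (144 * (1 + B) ^ 2))).const_mul A)
  filter_upwards [hbound.bound, hsnr.eventually_gt_atTop 0,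
    hsmall.eventually_le_const one_half_pos] with m hbudget hτσ hm
  have hnm : (0 : ℝ) < n m := by exact_mod_cast hn m
  have hpm : (0 : ℝ) < p m := by exact_mod_cast hp m
  have hkm : (0 : ℝ) < k m := by exact_mod_cast hk m
  have hσm := hσ m
  have hτm : 0 < τ m := (div_pos_iff_of_pos_right hσm).1 hτσ
  rw [Real.norm_of_nonneg (by positivity), Real.norm_of_nonneg (by positivity)] at hbudget
  have hV : k m * τ m ^ 2 / n m + σ m ^ 2 ≤ (1 + B) * σ m ^ 2 := by
    have : k m * τ m ^ 2 / n m ≤ B * σ m ^ 2 := by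
      rw [div_le_iff₀ hnm]
      linarith
    linarith
  refine toReal_sparseMinimaxRisk_le (hn m) (hk m) (by positivity) hτm hV
    (le_trans (le_of_eq ?_) hm)
  simp only [hs]
  field_simp

theorem eventually_sq_le_of_isLittleO_sqrt {f g : ι → ℝ} (hfg : f =o[l] fun m => √(g m))
    (hf : Tendsto f l atTop) : ∀ᶠ m in l, f m ^ 2 ≤ g m := by
  filter_upwards [hfg.bound one_pos, hf.eventually_gt_atTop 0] with m hle hpos
  rw [one_mul, Real.norm_of_nonneg hpos.le, Real.norm_of_nonneg (Real.sqrt_nonneg _)] at hle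
  exact (Real.le_sqrt' hpos).1 hle

theorem tendsto_mul_sq_div_mul_sq_of_sq_le_log {p k τ σ : ι → ℝ}
    (hkp_nonneg : ∀ m, 0 ≤ k m / p m) (hkp : Tendsto (fun m => k m / p m) l (𝓝 0))
    (hlog : ∀ᶠ m in l, (τ m / σ m) ^ 2 ≤ Real.log (p m / k m)) :
    Tendsto (fun m => k m * τ m ^ 2 / (p m * σ m ^ 2)) l (𝓝 0) := by
  have hlim : Tendsto (fun m => Real.negMulLog (k m / p m)) l (𝓝 0) := by
    simpa [Function.comp_def] using (Real.continuous_negMulLog.tendsto 0).comp hkp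
  have hfactor (m : ι) :
      k m * τ m ^ 2 / (p m * σ m ^ 2) = k m / p m * (τ m / σ m) ^ 2 := by
    rw [div_pow, mul_div_mul_comm]
  simp only [hfactor]
  refine squeeze_zero' (Eventually.of_forall fun m => ?_) (hlog.mono fun m hm => ?_) hlim
  · exact mul_nonneg (hkp_nonneg m) (sq_nonneg _)
  · calc k m / p m * (τ m / σ m) ^ 2 ≤ k m / p m * Real.log (p m / k m) :=
          mul_le_mul_of_nonneg_left hm (hkp_nonneg m)
      _ = Real.negMulLog (k m / p m) := by
          rw [Real.negMulLog, ← inv_div (k m) (p m), Real.log_inv, mul_neg, neg_mul]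

theorem isBigO_mul_sq_of_sq_le_log {n p k τ σ : ι → ℝ} (hn : ∀ m, 0 < n m) (hk : ∀ m, 0 ≤ k m)
    (hσ : ∀ m, 0 < σ m)
    (hkn : Tendsto (fun m => k m * Real.log (p m / k m) / n m) l (𝓝 0))
    (hlog : ∀ᶠ m in l, (τ m / σ m) ^ 2 ≤ Real.log (p m / k m)) :
    (fun m => k m * τ m ^ 2) =O[l] fun m => n m * σ m ^ 2 := by
  refine IsBigO.of_bound 1 ?_
  filter_upwards [hlog, hkn.eventually_le_const one_pos] with m hsq hone
  have hkm := hk m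
  have hnm := hn m
  have hσm := hσ m
  rw [div_le_one hnm] at hone
  rw [one_mul, Real.norm_of_nonneg (by positivity), Real.norm_of_nonneg (by positivity)]
  calc k m * τ m ^ 2 = k m * (τ m / σ m) ^ 2 * σ m ^ 2 := by field_simp
    _ ≤ k m * Real.log (p m / k m) * σ m ^ 2 := by gcongr
    _ ≤ n m * σ m ^ 2 := by gcongr

theorem mainTheorem5_general {n p k : ι → ℕ} {τ σ : ι → ℝ}
    (hn : ∀ m, 0 < n m) (hp : ∀ m, 0 < p m) (hk : ∀ m, 0 < k m) (hσ : ∀ m, 0 < σ m)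
    (hsnr : Tendsto (fun m => τ m / σ m) l atTop)
    (hgain : Tendsto (fun m => k m * τ m ^ 2 / (p m * σ m ^ 2)) l (𝓝 0))
    (hsample : (fun m => k m * τ m ^ 2) =O[l] fun m => n m * σ m ^ 2) :
    (∀ m, k m * τ m ^ 2 * (1 - k m * τ m ^ 2 / (p m * σ m ^ 2)) ≤
      (ridgeOptimalRisk (n m) (p m) (k m) (τ m) (σ m)).toReal) ∧
    (fun m => k m * τ m ^ 2 - (ridgeOptimalRisk (n m) (p m) (k m) (τ m) (σ m)).toReal) =o[l]
      (fun m => k m * τ m ^ 2 - (sparseMinimaxRisk (n m) (p m) (k m) (τ m) (σ m)).toReal) := by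
  have hridge (m : ι) := le_toReal_ridgeOptimalRisk (hn m) (hp m) (hk m) (hσ m) (τ m)
  refine ⟨hridge, isLittleO_iff.2 fun C hC => ?_⟩
  filter_upwards [eventually_toReal_sparseMinimaxRisk_le hn hp hk hσ hsnr hgain hsample
    (inv_pos.2 hC).le] with m hminimax
  have hridge_gain : k m * τ m ^ 2 - (ridgeOptimalRisk (n m) (p m) (k m) (τ m) (σ m)).toReal ≤
      k m * τ m ^ 2 * (k m * τ m ^ 2 / (p m * σ m ^ 2)) := by linarith [hridge m]
  have hminimax_gain : C⁻¹ * (k m * τ m ^ 2 * (k m * τ m ^ 2 / (p m * σ m ^ 2))) ≤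
      k m * τ m ^ 2 - (sparseMinimaxRisk (n m) (p m) (k m) (τ m) (σ m)).toReal := by
    linarith
  rw [Real.norm_of_nonneg (sub_nonneg.2 (toReal_ridgeOptimalRisk_le ..)),
    Real.norm_of_nonneg (le_trans (by positivity) hminimax_gain)]
  exact hridge_gain.trans ((inv_mul_le_iff₀ hC).1 hminimax_gain)

end Asymptotics

theorem mainTheorem5 (n p k : ℕ → ℕ) (τ σ : ℕ → ℝ)
    (hn : ∀ m, 0 < n m) (hp : ∀ m, 0 < p m) (hk : ∀ m, 0 < k m) (hσ : ∀ m, 0 < σ m)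
    (hkp : Tendsto (fun m => (k m : ℝ) / p m) atTop (𝓝 0))
    (hsnr : Tendsto (fun m => τ m / σ m) atTop atTop)
    (hsnr' : (fun m => τ m / σ m) =o[atTop] fun m => Real.sqrt (Real.log ((p m : ℝ) / k m)))
    (hkn : Tendsto (fun m => (k m : ℝ) * Real.log ((p m : ℝ) / k m) / n m) atTop (𝓝 0)) :
    (∃ δ : ℕ → ℝ, Tendsto δ atTop (𝓝 0) ∧
      ∀ᶠ m in atTop,
        k m * τ m ^ 2 * (1 - k m * τ m ^ 2 / (p m * σ m ^ 2) * (1 + δ m)) ≤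
          (ridgeOptimalRisk (n m) (p m) (k m) (τ m) (σ m)).toReal) ∧
    (fun m => k m * τ m ^ 2 - (ridgeOptimalRisk (n m) (p m) (k m) (τ m) (σ m)).toReal) =o[atTop]
      (fun m => k m * τ m ^ 2 - (sparseMinimaxRisk (n m) (p m) (k m) (τ m) (σ m)).toReal) := by
  have hlog := eventually_sq_le_of_isLittleO_sqrt hsnr' hsnr
  obtain ⟨hridge, hgap⟩ := mainTheorem5_general hn hp hk hσ hsnr
    (tendsto_mul_sq_div_mul_sq_of_sq_le_log (fun m => by positivity) hkp hlog)
    (isBigO_mul_sq_of_sq_le_log (fun m => by exact_mod_cast hn m) (fun m => by positivity) hσ hkn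
      hlog)
  refine ⟨⟨0, tendsto_const_nhds, Eventually.of_forall fun m => ?_⟩, hgap⟩
  simpa using hridge m
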